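/- Let $p$ be a prime. An abelian Polish group is a Lie group if it is isomorphic, as a topological group, to $\mathbb{R}^{n}\oplus \mathbb{T}^{d}\oplus D$ for some $n,d\in\mathbb{N}$ and some countable discrete abelian group $D$. A closed subgroup $N$ of a Polish abelian group $A$ is co-Lie if $A/N$ is a Lie group, and $A$ is pro-Lie if every zero neighborhood of $A$ contains a co-Lie closed subgroup. A locally compact Polish abelian group $B$ is a topological $p$-group if $\lim_{n}p^{n}x=0$ for every $x\in B$; a pro-Lie Polish abelian group $A$ is a topological $p$-group if every co-Lie closed subgroup $N$ of $A$ contains a co-Lie closed subgroup $M$ such that $A/M$ is a topological $p$-group. A pro-$p$ Polish abelian group is a pro-Lie Polish abelian group that is a topological $p$-group. Let $\mathbf{PAb}(p)$ be the category of pro-$p$ Polish abelian groups and continuous homomorphisms, and $\mathbf{LCPAb}(p)$ its full subcategory of locally compact groups. An object $I$ of one of these categories is injective if, within that category, for every short exact sequence $X_{1}\to X_{2}\to X_{3}$ (that is, every kernel-cokernel pair) the induced sequence $0\to \mathrm{Hom}(X_{3},I)\to \mathrm{Hom}(X_{2},I)\to \mathrm{Hom}(X_{1},I)\to 0$ is exact.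 **Theorem.** Let $G$ be a locally compact pro-$p$ Polish abelian group. The following assertions are equivalent: 1. $G$ is injective in $\mathbf{LCPAb}(p)$; 2. $G$ is injective in $\mathbf{PAb}(p)$; 3. $G$ is a countable divisible $p$-group (that is, $G$ is countable, every $x\in G$ is divisible by every positive integer, and every $x\in G$ satisfies $p^{k}x=0$ for some $k$). -/

import Mathlib

open CategoryTheory CategoryTheory.Limits Filter Topology

universe v u

namespace PolishAb

section Groups

variable (A : Type u) [AddCommGroup A] [TopologicalSpace A]

/-- An abelian Polish Lie group: a topological group of the form `V ⊕ T ⊕ D`, where `V` is a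
finite-dimensional vector group, `T` a finite-dimensional torus, and `D` a countable discrete
group. -/
def IsLie : Prop :=
  ∃ (n d : ℕ) (D : Type u) (_ : AddCommGroup D) (_ : TopologicalSpace D),
    DiscreteTopology D ∧ Countable D ∧
      Nonempty (A ≃ₜ+ ((Fin n → ℝ) × (Fin d → UnitAddCircle) × D))

variable {A} in
/-- The co-Lie closed subgroups of `A`: closed subgroups `N` such that `A ⧸ N` is a Lie group. -/
def IsCoLie (N : AddSubgroup A) : Prop :=
  IsClosed (N : Set A) ∧ IsLie (A ⧸ N)

/-- `A` is pro-Lie: every zero neighborhood contains a co-Lie closed subgroup. -/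
def IsProLie : Prop :=
  ∀ U ∈ 𝓝 (0 : A), ∃ N : AddSubgroup A, IsCoLie N ∧ (N : Set A) ⊆ U

/-- Topological `p`-groups among the locally compact groups: `p ^ n x → 0` for every `x`. -/
def IsTopologicalPGroupLC (p : ℕ) : Prop :=
  ∀ x : A, Tendsto (fun n : ℕ => (p ^ n) • x) atTop (𝓝 0)

/-- Topological `p`-groups among the pro-Lie groups: the co-Lie closed subgroups `M` such that the
(locally compact) group `A ⧸ M` is a topological `p`-group are cofinal, with respect to reverse
inclusion, among all co-Lie closed subgroups. -/
def IsTopologicalPGroup (p : ℕ) : Prop :=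
  ∀ N : AddSubgroup A, IsCoLie N →
    ∃ M : AddSubgroup A, M ≤ N ∧ IsCoLie M ∧ IsTopologicalPGroupLC (A ⧸ M) p

/-- Pro-`p` Polish abelian groups: pro-Lie Polish abelian topological `p`-groups. -/
structure IsProP (p : ℕ) : Prop where
  polish : PolishSpace A
  proLie : IsProLie A
  pGroup : IsTopologicalPGroup A p

end Groups

/-- Being pro-`p` Polish, as a property of objects of the category of topological abelian groups
and continuous homomorphisms (that is, of topological `ℤ`-modules for discrete `ℤ`). -/
def proP (p : ℕ) : ObjectProperty (TopModuleCat.{u} ℤ) :=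
  fun A => IsProP A p

/-- Being locally compact pro-`p` Polish. -/
def lcProP (p : ℕ) : ObjectProperty (TopModuleCat.{u} ℤ) :=
  fun A => LocallyCompactSpace A ∧ IsProP A p

/-- The category of pro-`p` Polish abelian groups and continuous homomorphisms. -/
abbrev PAb (p : ℕ) := (proP.{u} p).FullSubcategory

/-- The category of locally compact pro-`p` Polish abelian groups and continuous homomorphisms. -/
abbrev LCPAb (p : ℕ) := (lcProP.{u} p).FullSubcategory

section Injective

variable {C : Type u} [Category.{v} C] [HasZeroMorphisms C]

/-- `X₁ ⟶ X₂ ⟶ X₃` is a kernel-cokernel pair, that is, a short exact sequence in the canonical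
exact structure of a quasi-abelian category. -/
def IsKernelCokernelPair (S : ShortComplex C) : Prop :=
  Nonempty (IsLimit (KernelFork.ofι S.f S.zero)) ∧
    Nonempty (IsColimit (CokernelCofork.ofπ S.g S.zero))

/-- Injective objects for the canonical exact structure: `Hom(-, I)` carries every kernel-cokernel
pair `X₁ ⟶ X₂ ⟶ X₃` to a short exact sequence
`0 → Hom(X₃, I) → Hom(X₂, I) → Hom(X₁, I) → 0`. -/
def IsInjective (I : C) : Prop :=
  ∀ S : ShortComplex C, IsKernelCokernelPair S →
    Function.Injective (fun h : S.X₃ ⟶ I => S.g ≫ h) ∧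
    Function.Exact (fun h : S.X₃ ⟶ I => S.g ≫ h) (fun h : S.X₂ ⟶ I => S.f ≫ h) ∧
    Function.Surjective (fun h : S.X₂ ⟶ I => S.f ≫ h)

end Injective

end PolishAb

/-! A Lie group satisfying `p ^ n • x → 0` has no `ℝ` or `𝕋` factor, so pro-`p` Polish groups are
exactly the nonarchimedean Polish abelian groups with `p ^ n • x → 0`.

Sufficiency (`isInjective_of_divisible`): a countable Polish group is discrete by Baire. A
homomorphism from a subgroup `Y ≤ X` to a discrete group kills `Y ∩ M` for some open subgroup `M`,
so extending it is the algebraic problem for `Y / (Y ∩ M) → X / M`, solved by Baer's criterion.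

Necessity (`IsInjective.countable_divisible_pGroup`): test injectivity on the diagonal map `(k i)`
of `ℤ_[p] ^ ℕ`. Null sequences in `G` are the images of the unit vectors, so every null sequence `a`
is `k i • b i` with `b` null. If `G` were not discrete, take nonzero `a i → 0`, a compact zero
neighborhood `K`, and `k i` so large that `a i ∉ p ^ k i • K`: then `b` never enters `K`. So `G` is
discrete, hence countable and `p`-primary; constant `k` gives divisibility. -/

namespace PolishAb

/-! ### Pro-`p` groups as nonarchimedean groups -/

section ProP

variable {A : Type u} [AddCommGroup A] [TopologicalSpace A] {p : ℕ}

theorem IsTopologicalPGroupLC.of_surjective {B : Type*} [AddCommGroup B] [TopologicalSpace B]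
    (h : IsTopologicalPGroupLC A p) (f : A →+ B) (hf : Continuous f)
    (hs : Function.Surjective f) : IsTopologicalPGroupLC B p := by
  intro y
  obtain ⟨x, rfl⟩ := hs y
  simpa [Function.comp_def] using (hf.tendsto 0).comp (h x)

theorem not_isTopologicalPGroupLC_real (hp : p.Prime) : ¬ IsTopologicalPGroupLC ℝ p := by
  intro h
  have h1 : Tendsto (fun n : ℕ => (p : ℝ) ^ n) atTop (𝓝 0) := by simpa using h 1
  exact not_tendsto_nhds_of_tendsto_atTop
    (tendsto_pow_atTop_atTop_of_one_lt (by exact_mod_cast hp.one_lt)) 0 h1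

theorem not_isTopologicalPGroupLC_unitAddCircle (hp : p.Prime) :
    ¬ IsTopologicalPGroupLC UnitAddCircle p := by
  intro h
  have hp0 : (0 : ℝ) < p := by exact_mod_cast hp.pos
  -- On a point of order `p + 1`, multiplication by `p` is negation, so even powers of `p` fix it.
  set x : UnitAddCircle := ((1 / (p + 1) : ℝ) : UnitAddCircle) with hx
  have hx0 : x ≠ 0 := by
    rw [hx, Ne, AddCircle.coe_eq_zero_iff_of_mem_Ico]
    · positivity
    · constructor
      · positivity
      · rw [div_lt_one] <;> linarith
  have h1 : (p + 1) • x = 0 := by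
    rw [hx, ← AddCircle.coe_nsmul, nsmul_eq_mul]
    have : ((p + 1 : ℕ) : ℝ) * (1 / (p + 1)) = 1 := by push_cast; field_simp
    rw [this]
    exact AddCircle.coe_period 1
  have h2 : p • x = -x := by
    rw [succ_nsmul] at h1
    exact eq_neg_of_add_eq_zero_left h1
  have h3 : ∀ n : ℕ, p ^ (2 * n) • x = x := by
    intro n
    induction n with
    | zero => simp
    | succ n ih =>
      rw [show 2 * (n + 1) = 2 * n + 1 + 1 by ring, pow_succ, mul_nsmul', h2, pow_succ, smul_neg,
        mul_nsmul', h2, smul_neg, neg_neg, ih]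
  have h4 : Tendsto (fun n : ℕ => p ^ (2 * n) • x) atTop (𝓝 0) :=
    (h x).comp (tendsto_id.const_mul_atTop' two_pos)
  simp only [h3] at h4
  exact hx0 (tendsto_nhds_unique tendsto_const_nhds h4)

/-- A Lie group that is a topological `p`-group is discrete. -/
theorem IsLie.discreteTopology (hp : p.Prime) (hA : IsLie A) (h : IsTopologicalPGroupLC A p) :
    DiscreteTopology A := by
  obtain ⟨n, d, D, _, _, _, _, ⟨e⟩⟩ := hA
  have hprod := h.of_surjective e.toAddEquiv.toAddMonoidHom e.continuous e.surjective
  have hn : IsEmpty (Fin n) := by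
    by_contra hne
    rw [not_isEmpty_iff] at hne
    obtain ⟨i⟩ := hne
    refine not_isTopologicalPGroupLC_real hp (hprod.of_surjective
      ((Pi.evalAddMonoidHom _ i).comp (AddMonoidHom.fst _ _))
      ((continuous_apply i).comp continuous_fst) fun y => ⟨(fun _ => y, 0), rfl⟩)
  have hd : IsEmpty (Fin d) := by
    by_contra hne
    rw [not_isEmpty_iff] at hne
    obtain ⟨i⟩ := hne
    refine not_isTopologicalPGroupLC_unitAddCircle hp (hprod.of_surjective
      ((Pi.evalAddMonoidHom _ i).comp ((AddMonoidHom.fst _ _).comp (AddMonoidHom.snd _ _)))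
      ((continuous_apply i).comp (continuous_fst.comp continuous_snd))
      fun y => ⟨(0, fun _ => y, 0), rfl⟩)
  have : DiscreteTopology ((Fin n → ℝ) × (Fin d → UnitAddCircle) × D) := inferInstance
  exact e.toHomeomorph.symm.discreteTopology

/-- A co-Lie subgroup whose quotient is a topological `p`-group has discrete quotient, so it is
open. -/
theorem IsProP.exists_openAddSubgroup [IsTopologicalAddGroup A] (hp : p.Prime) (h : IsProP A p)
    {U : Set A} (hU : U ∈ 𝓝 0) :
    ∃ M : OpenAddSubgroup A, (M : Set A) ⊆ U ∧ ∀ x : A, ∀ᶠ n : ℕ in atTop, p ^ n • x ∈ M := by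
  obtain ⟨N, hN, hNU⟩ := h.proLie U hU
  obtain ⟨M, hMN, hM, hMp⟩ := h.pGroup N hN
  have := hM.2.discreteTopology hp hMp
  have hMo : IsOpen (M : Set A) := QuotientAddGroup.discreteTopology_iff.1 this
  refine ⟨⟨M, hMo⟩, fun x hx => hNU (hMN hx), fun x => ?_⟩
  have hev := (hMp (x : A ⧸ M)).eventually (isOpen_discrete {0} |>.mem_nhds rfl)
  filter_upwards [hev] with n hn
  exact (QuotientAddGroup.eq_zero_iff (p ^ n • x)).1 hn

theorem IsProP.nonarchimedeanAddGroup [IsTopologicalAddGroup A] (hp : p.Prime) (h : IsProP A p) :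
    NonarchimedeanAddGroup A where
  is_nonarchimedean _ hU := (h.exists_openAddSubgroup hp hU).imp fun _ hM => hM.1

theorem IsProP.isTopologicalPGroupLC [IsTopologicalAddGroup A] (hp : p.Prime) (h : IsProP A p) :
    IsTopologicalPGroupLC A p := by
  intro x
  rw [tendsto_def]
  intro U hU
  obtain ⟨M, hMU, hM⟩ := h.exists_openAddSubgroup hp hU
  filter_upwards [hM x] with n hn using hMU hn

theorem isCoLie_of_isOpen [IsTopologicalAddGroup A] [PolishSpace A] {M : AddSubgroup A}
    (hM : IsOpen (M : Set A)) : IsCoLie M := by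
  refine ⟨AddSubgroup.isClosed_of_isOpen M hM, 0, 0, A ⧸ M, inferInstance, inferInstance,
    QuotientAddGroup.discreteTopology hM, ?_, ⟨?_⟩⟩
  · have := QuotientAddGroup.discreteTopology hM
    exact TopologicalSpace.separableSpace_iff_countable.1 inferInstance
  · exact
      { toFun x := (0, 0, x)
        invFun x := x.2.2
        left_inv _ := rfl
        right_inv x := Prod.ext (Subsingleton.elim _ _) (Prod.ext (Subsingleton.elim _ _) rfl)
        map_add' x y := by simp
        continuous_toFun := by fun_prop
        continuous_invFun := by fun_prop }

theorem IsProP.of_nonarchimedean [NonarchimedeanAddGroup A] [PolishSpace A]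
    (h : IsTopologicalPGroupLC A p) : IsProP A p where
  polish := inferInstance
  proLie U hU := by
    obtain ⟨M, hM⟩ := NonarchimedeanAddGroup.is_nonarchimedean U hU
    exact ⟨M, isCoLie_of_isOpen M.isOpen, hM⟩
  pGroup N hN := ⟨N, le_rfl, hN, h.of_surjective (QuotientAddGroup.mk' N)
    QuotientAddGroup.continuous_mk (QuotientAddGroup.mk'_surjective N)⟩

theorem NonarchimedeanAddGroup.of_isInducing {B : Type*} [AddCommGroup B] [TopologicalSpace B]
    [IsTopologicalAddGroup B] [NonarchimedeanAddGroup A] (f : B →+ A) (hf : IsInducing f) :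
    NonarchimedeanAddGroup B where
  is_nonarchimedean U hU := by
    rw [hf.nhds_eq_comap, map_zero] at hU
    obtain ⟨V, hV, hVU⟩ := hU
    obtain ⟨M, hM⟩ := NonarchimedeanAddGroup.is_nonarchimedean V hV
    exact ⟨M.comap f hf.continuous, fun x hx => hVU (hM hx)⟩

theorem NonarchimedeanAddGroup.of_isOpenMap {B : Type*} [AddCommGroup B] [TopologicalSpace B]
    [IsTopologicalAddGroup B] [NonarchimedeanAddGroup A] (f : A →+ B) (hf : Continuous f)
    (ho : IsOpenMap f) : NonarchimedeanAddGroup B where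
  is_nonarchimedean U hU := by
    obtain ⟨M, hM⟩ := NonarchimedeanAddGroup.is_nonarchimedean (f ⁻¹' U)
      (hf.continuousAt (x := 0) (by simpa using hU))
    refine ⟨⟨M.toAddSubgroup.map f, ho _ M.isOpen⟩, ?_⟩
    rintro _ ⟨x, hx, rfl⟩
    exact hM hx

instance NonarchimedeanAddGroup.pi {ι : Type*} {B : ι → Type*} [∀ i, AddCommGroup (B i)]
    [∀ i, TopologicalSpace (B i)] [∀ i, NonarchimedeanAddGroup (B i)] :
    NonarchimedeanAddGroup (∀ i, B i) where
  is_nonarchimedean U hU := by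
    classical
    rw [nhds_pi, mem_pi] at hU
    obtain ⟨I, hI, t, ht, hU⟩ := hU
    choose M hM using fun i => NonarchimedeanAddGroup.is_nonarchimedean (t i) (ht i)
    refine ⟨⟨AddSubgroup.pi I fun i => M i, isOpen_set_pi hI fun i _ => (M i).isOpen⟩, ?_⟩
    exact fun x hx => hU fun i hi => hM i (hx i hi)

theorem IsProP.of_isClosedEmbedding {B : Type u} [AddCommGroup B] [TopologicalSpace B]
    [IsTopologicalAddGroup A] [IsTopologicalAddGroup B] (hp : p.Prime) (h : IsProP A p)
    (f : B →+ A) (hf : IsClosedEmbedding f) : IsProP B p := by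
  have := h.nonarchimedeanAddGroup hp
  have := h.polish
  have := hf.polishSpace
  have := NonarchimedeanAddGroup.of_isInducing f hf.isInducing
  refine .of_nonarchimedean fun x => ?_
  rw [hf.isInducing.tendsto_nhds_iff]
  simpa [Function.comp_def] using h.isTopologicalPGroupLC hp (f x)

/-- By Baire, some singleton has nonempty interior; translate it to zero. -/
theorem discreteTopology_of_countable [IsTopologicalAddGroup A] [PolishSpace A] [Countable A] :
    DiscreteTopology A := by
  obtain ⟨x, y, hy⟩ := nonempty_interior_of_iUnion_of_closed (f := fun x : A => ({x} : Set A))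
    (fun _ => isClosed_singleton) (by ext; simp)
  have hxy : y = x := by simpa using interior_subset hy
  subst hxy
  rw [discreteTopology_iff_isOpen_singleton_zero]
  have : IsOpen ({y} : Set A) := by
    rw [← interior_eq_iff_isOpen]
    exact interior_subset.antisymm (by simpa using hy)
  simpa using this.preimage (continuous_const_add y)

end ProP

/-! ### Extending homomorphisms into discrete divisible groups -/

section Extension

/-- A continuous homomorphism to a discrete divisible group extends from a subgroup of a
nonarchimedean group to the whole group. -/
theorem exists_extension_of_divisible {X Y G : Type u} [AddCommGroup X] [TopologicalSpace X]
    [NonarchimedeanAddGroup X] [AddCommGroup Y] [TopologicalSpace Y] [AddCommGroup G]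
    [TopologicalSpace G] [DiscreteTopology G] [Module ℤ X] [Module ℤ Y] [Module ℤ G]
    (hdiv : ∀ n : ℕ, n ≠ 0 → ∀ x : G, ∃ y : G, n • y = x) (f : Y →L[ℤ] X) (hf : IsInducing f)
    (φ : Y →L[ℤ] G) : ∃ ψ : X →L[ℤ] G, ∀ y : Y, ψ (f y) = φ y := by
  obtain rfl := Subsingleton.elim ‹Module ℤ X› (AddCommGroup.toIntModule X)
  obtain rfl := Subsingleton.elim ‹Module ℤ Y› (AddCommGroup.toIntModule Y)
  obtain rfl := Subsingleton.elim ‹Module ℤ G› (AddCommGroup.toIntModule G)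
  have hdiv' : ∀ {n : ℤ}, n ≠ 0 → Function.Surjective fun x : G => n • x := by
    intro n hn x
    obtain ⟨y, hy⟩ := hdiv n.natAbs (Int.natAbs_ne_zero.2 hn) x
    obtain h | h := Int.natAbs_eq n
    · exact ⟨y, by rw [← hy, ← natCast_zsmul, ← h]⟩
    · exact ⟨-y, by
        simp only
        rw [← hy, ← natCast_zsmul, smul_neg, ← neg_smul, neg_eq_iff_eq_neg.2 h]⟩
  let _ : DivisibleBy G ℤ := divisibleByOfSMulRightSurj G ℤ hdiv'
  have hinj : Module.Injective ℤ G := (Module.Baer.of_divisible G).injective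
  have hker : φ ⁻¹' {0} ∈ 𝓝 (0 : Y) :=
    φ.continuous.continuousAt (by rw [map_zero]; exact (isOpen_discrete _).mem_nhds rfl)
  rw [hf.nhds_eq_comap, map_zero] at hker
  obtain ⟨U, hU, hUker⟩ := hker
  obtain ⟨M, hM⟩ := NonarchimedeanAddGroup.is_nonarchimedean U hU
  let M' : Submodule ℤ X := AddSubgroup.toIntSubmodule M.toAddSubgroup
  let f' : Y →ₗ[ℤ] X := f
  have hle : M'.comap f' ≤ LinearMap.ker (φ : Y →ₗ[ℤ] G) := fun y hy => hUker (hM hy)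
  -- Dividing by the full preimage of `M'` keeps the induced map into `X ⧸ M'` injective. The
  -- extension factors through `X ⧸ M'`, hence is continuous.
  obtain ⟨h, hh⟩ := hinj.out ((M'.comap f').mapQ M' f' le_rfl)
    (by
      rw [← LinearMap.ker_eq_bot, Submodule.ker_mapQ]
      simp)
    ((M'.comap f').liftQ (φ : Y →ₗ[ℤ] G) hle)
  refine ⟨⟨h ∘ₗ M'.mkQ, ?_⟩, fun y => hh (Submodule.Quotient.mk y)⟩
  refine continuous_of_continuousAt_zero (h ∘ₗ M'.mkQ) ?_
  rw [ContinuousAt, map_zero, nhds_discrete G, tendsto_pure]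
  filter_upwards [M.mem_nhds_zero] with x hx
  have : M'.mkQ x = 0 := (Submodule.Quotient.mk_eq_zero M').2 hx
  simp [this]

end Extension

/-! ### Powers of the `p`-adic integers and null families -/

section Padic

variable {p : ℕ} [Fact p.Prime] {ι : Type u}

theorem isProP_padicInt_pi [Countable ι] : IsProP (ι → ℤ_[p]) p := by
  refine .of_nonarchimedean fun x => ?_
  rw [tendsto_pi_nhds]
  intro i
  have h : Tendsto (fun n : ℕ => (p : ℤ_[p]) ^ n * x i) atTop (𝓝 (0 * x i)) :=
    (tendsto_pow_atTop_nhds_zero_of_norm_lt_one (PadicInt.norm_lt_one_iff_dvd _ |>.2 dvd_rfl)).mul_const _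
  simpa using h

theorem isProP_padicInt_pi_quotient [Countable ι] (Y : Submodule ℤ (ι → ℤ_[p]))
    (hY : IsClosed (Y : Set (ι → ℤ_[p]))) : IsProP ((ι → ℤ_[p]) ⧸ Y) p := by
  have : CompactSpace ((ι → ℤ_[p]) ⧸ Y) := Quotient.compactSpace
  have : SecondCountableTopology ((ι → ℤ_[p]) ⧸ Y) :=
    Y.isOpenQuotientMap_mkQ.isQuotientMap.secondCountableTopology Y.isOpenMap_mkQ
  have : PolishSpace ((ι → ℤ_[p]) ⧸ Y) := by
    let := TopologicalSpace.metrizableSpaceMetric ((ι → ℤ_[p]) ⧸ Y)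
    infer_instance
  have := NonarchimedeanAddGroup.of_isOpenMap Y.mkQ.toAddMonoidHom
    Y.isOpenQuotientMap_mkQ.continuous Y.isOpenMap_mkQ
  exact .of_nonarchimedean <|
    (isProP_padicInt_pi.isTopologicalPGroupLC (Fact.out : p.Prime)).of_surjective
      Y.mkQ.toAddMonoidHom Y.isOpenQuotientMap_mkQ.continuous Y.mkQ_surjective

/-- The coordinatewise inclusion of the finitely supported integral families in the families of
`p`-adic integers. -/
noncomputable def finsuppIntToPadicInt (p : ℕ) [Fact p.Prime] (ι : Type u) :
    (ι →₀ ℤ) →ₗ[ℤ] (ι → ℤ_[p]) :=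
  LinearMap.pi fun i => (Int.castAddHom ℤ_[p]).toIntLinearMap ∘ₗ Finsupp.lapply i

@[simp]
theorem finsuppIntToPadicInt_apply (x : ι →₀ ℤ) (i : ι) :
    finsuppIntToPadicInt p ι x i = x i := rfl

theorem denseRange_finsuppIntToPadicInt : DenseRange (finsuppIntToPadicInt p ι) := by
  classical
  intro x
  rw [mem_closure_iff_nhds]
  intro U hU
  rw [nhds_pi, mem_pi] at hU
  obtain ⟨I, hI, t, ht, hU⟩ := hU
  choose n hn using fun i => PadicInt.denseRange_intCast.exists_mem_open
    (isOpen_interior (s := t i)) ⟨x i, mem_interior_iff_mem_nhds.2 (ht i)⟩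
  refine ⟨_, hU fun i hi => ?_, Finsupp.indicator hI.toFinset fun i _ => n i, rfl⟩
  rw [finsuppIntToPadicInt_apply, Finsupp.indicator_of_mem (hI.mem_toFinset.2 hi)]
  exact interior_subset (hn i)

/-- A null family in a locally compact pro-`p` group defines a continuous homomorphism from a
power of the `p`-adic integers. -/
theorem exists_hom_padicInt_pi {G : Type u} [AddCommGroup G] [TopologicalSpace G]
    [IsTopologicalAddGroup G] [LocallyCompactSpace G] [DecidableEq ι] (hG : IsProP G p)
    {a : ι → G} (ha : Tendsto a cofinite (𝓝 0)) :
    ∃ φ : (ι → ℤ_[p]) →L[ℤ] G, ∀ i, φ (Pi.single i 1) = a i := by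
  have hp : p.Prime := Fact.out
  have := hG.polish
  let _ : UniformSpace G := IsTopologicalAddGroup.rightUniformSpace G
  have : IsUniformAddGroup G := isUniformAddGroup_of_addCommGroup
  have : CompleteSpace G := IsRightUniformAddGroup.completeSpace_of_weaklyLocallyCompactSpace
  let _ : UniformSpace (ι →₀ ℤ) := UniformSpace.comap (finsuppIntToPadicInt p ι) inferInstance
  have : IsUniformAddGroup (ι →₀ ℤ) := IsUniformAddGroup.comap (finsuppIntToPadicInt p ι)
  have he : IsUniformInducing (finsuppIntToPadicInt p ι) := ⟨rfl⟩
  have hf : Continuous (Finsupp.linearCombination ℤ a) := by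
    refine continuous_of_continuousAt_zero (Finsupp.linearCombination ℤ a) ?_
    rw [ContinuousAt, map_zero, tendsto_def]
    intro U hU
    obtain ⟨M, hMU, hM⟩ := hG.exists_openAddSubgroup hp hU
    have hfin : {i | a i ∉ M}.Finite := ha M.mem_nhds_zero
    choose k hk using fun i => (hM (a i)).exists
    -- The strict bound, visibly open, says `p ^ k i ∣ x i`; it is needed only at the finitely many
    -- `i` with `a i ∉ M`.
    have hV : (⋂ i ∈ {i | a i ∉ M}, {x : ι → ℤ_[p] | ‖x i‖ < (p : ℝ) ^ (-(k i : ℤ) + 1)}) ∈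
        𝓝 (0 : ι → ℤ_[p]) := by
      refine (biInter_mem hfin).2 fun i _ => ?_
      refine IsOpen.mem_nhds (isOpen_lt (by fun_prop) continuous_const) ?_
      have : (0 : ℝ) < p := by exact_mod_cast hp.pos
      simp only [Set.mem_ofPred_eq, Pi.zero_apply, norm_zero]
      positivity
    rw [he.isInducing.nhds_eq_comap, map_zero]
    refine ⟨_, hV, fun x hx => hMU ?_⟩
    rw [Finsupp.linearCombination_apply]
    refine sum_mem fun i _ => ?_
    by_cases hi : a i ∈ M
    · exact zsmul_mem hi _
    · have h1 := Set.mem_iInter₂.1 hx i hi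
      rw [Set.mem_ofPred_eq, finsuppIntToPadicInt_apply,
        ← PadicInt.norm_le_pow_iff_norm_lt_pow_add_one, PadicInt.norm_int_le_pow_iff_dvd] at h1
      obtain ⟨c, hc⟩ := h1
      simp only [hc, mul_comm _ c, mul_smul]
      refine zsmul_mem ?_ _
      have := hk i
      rwa [← natCast_zsmul, Nat.cast_pow] at this
  -- Extension by density; `G` is complete because it is locally compact.
  refine ⟨ContinuousLinearMap.extend ⟨Finsupp.linearCombination ℤ a, hf⟩
    ⟨finsuppIntToPadicInt p ι, he.uniformContinuous.continuous⟩, fun i => ?_⟩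
  have hi : (Pi.single i 1 : ι → ℤ_[p]) = finsuppIntToPadicInt p ι (Finsupp.single i 1) := by
    ext1 j
    rw [finsuppIntToPadicInt_apply, Finsupp.single_apply, Pi.single_apply]
    simp [eq_comm]
  rw [hi]
  refine (ContinuousLinearMap.extend_eq _ (e := ⟨finsuppIntToPadicInt p ι, _⟩)
    denseRange_finsuppIntToPadicInt he _).trans ?_
  simp

theorem tendsto_single_cofinite [DecidableEq ι] :
    Tendsto (fun i => (Pi.single i 1 : ι → ℤ_[p])) cofinite (𝓝 0) := by
  rw [tendsto_pi_nhds]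
  intro j
  refine tendsto_const_nhds.congr' ?_
  filter_upwards [(Set.finite_singleton j).compl_mem_cofinite] with i hi
  rw [Pi.single_eq_of_ne (Ne.symm hi)]; rfl

/-- Coordinatewise multiplication by natural numbers on a power of the `p`-adic integers. -/
noncomputable def padicIntPiMul (p : ℕ) [Fact p.Prime] (k : ι → ℕ) :
    (ι → ℤ_[p]) →L[ℤ] (ι → ℤ_[p]) :=
  ContinuousLinearMap.pi fun i => k i • ContinuousLinearMap.proj i

theorem padicIntPiMul_apply (k : ι → ℕ) (x : ι → ℤ_[p]) (i : ι) :
    padicIntPiMul p k x i = k i • x i := rfl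

theorem padicIntPiMul_single [DecidableEq ι] (k : ι → ℕ) (i : ι) :
    padicIntPiMul p k (Pi.single i 1) = k i • Pi.single i 1 := by
  ext1 j
  by_cases h : j = i
  · subst h; simp [padicIntPiMul_apply]
  · simp [padicIntPiMul_apply, Pi.single_eq_of_ne h]

theorem isClosedEmbedding_padicIntPiMul {k : ι → ℕ} (hk : ∀ i, k i ≠ 0) :
    IsClosedEmbedding (padicIntPiMul p k) := by
  refine (padicIntPiMul p k).continuous.isClosedEmbedding fun x y h => ?_
  ext1 i
  have hi := congrFun h i
  simp only [padicIntPiMul_apply, nsmul_eq_mul] at hi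
  exact mul_left_cancel₀ (Nat.cast_ne_zero.2 (hk i)) hi

/-- The unit vectors form a null family, so their images under `ψ` are the required quotients. -/
theorem exists_null_family_of_extension {G : Type u} [AddCommGroup G] [TopologicalSpace G]
    [IsTopologicalAddGroup G] [LocallyCompactSpace G] [Module ℤ G] (hG : IsProP G p) {k : ι → ℕ}
    (hext : ∀ φ : (ι → ℤ_[p]) →L[ℤ] G, ∃ ψ : (ι → ℤ_[p]) →L[ℤ] G,
      ψ.comp (padicIntPiMul p k) = φ)
    {a : ι → G} (ha : Tendsto a cofinite (𝓝 0)) :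
    ∃ b : ι → G, Tendsto b cofinite (𝓝 0) ∧ ∀ i, k i • b i = a i := by
  classical
  obtain rfl := Subsingleton.elim ‹Module ℤ G› (AddCommGroup.toIntModule G)
  obtain ⟨φ, hφ⟩ := exists_hom_padicInt_pi hG ha
  obtain ⟨ψ, rfl⟩ := hext φ
  refine ⟨fun i => ψ (Pi.single i 1), ?_, fun i => ?_⟩
  · have := (ψ.continuous.tendsto 0).comp (tendsto_single_cofinite (p := p) (ι := ι))
    rwa [map_zero] at this
  · rw [← hφ i, ContinuousLinearMap.comp_apply, padicIntPiMul_single, map_nsmul]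

end Padic

/-! ### Discreteness from division of null sequences -/

section LocallyCompact

variable {G : Type u} [AddCommGroup G] [TopologicalSpace G] [IsTopologicalAddGroup G] {p : ℕ}

/-- For an open subgroup `M` missing `x`, the sets `{y | p ^ k • y ∈ M}` are open, increasing in `k`
and cover `K`, so one of them contains `K`. -/
theorem IsProP.exists_pow_smul_ne (hp : p.Prime) (hG : IsProP G p) {K : Set G} (hK : IsCompact K)
    {x : G} (hx : x ≠ 0) : ∃ k : ℕ, ∀ y ∈ K, p ^ k • y ≠ x := by
  have := hG.polish
  obtain ⟨M, hMU, hM⟩ := hG.exists_openAddSubgroup hp (isOpen_ne.mem_nhds hx.symm)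
  obtain ⟨k, hk⟩ := hK.elim_directed_cover (fun k : ℕ => {y | p ^ k • y ∈ M})
    (fun k => M.isOpen.preimage (continuous_nsmul _))
    (fun y _ => Set.mem_iUnion.2 (hM y).exists)
    (Monotone.directed_le <| monotone_nat_of_le_succ fun n y hy => by
      change p ^ (n + 1) • y ∈ M
      rw [pow_succ', mul_smul]
      exact nsmul_mem hy p)
  exact ⟨k, fun y hy h => hMU (hk hy) h⟩

theorem IsProP.discreteTopology_of_null_division [LocallyCompactSpace G] (hp : p.Prime)
    (hG : IsProP G p)
    (h : ∀ (k : ℕ → ℕ) (a : ℕ → G), Tendsto a atTop (𝓝 0) →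
      ∃ b : ℕ → G, Tendsto b atTop (𝓝 0) ∧ ∀ i, p ^ k i • b i = a i) : DiscreteTopology G := by
  have := hG.polish
  by_contra hd
  have hne : (𝓝[≠] (0 : G)).NeBot := by
    refine ⟨fun hbot => hd ?_⟩
    rw [discreteTopology_iff_isOpen_singleton_zero]
    exact isOpen_singleton_iff_punctured_nhds 0 |>.2 hbot
  obtain ⟨a, ha⟩ := exists_seq_tendsto (𝓝[≠] (0 : G))
  rw [tendsto_nhdsWithin_iff] at ha
  obtain ⟨N, hN⟩ := eventually_atTop.1 ha.2
  obtain ⟨K, hK, hK0⟩ := exists_compact_mem_nhds (0 : G)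
  choose k hk using fun i => hG.exists_pow_smul_ne hp hK (hN (i + N) (by omega))
  obtain ⟨b, hb, hab⟩ := h k (fun i => a (i + N)) ((tendsto_add_atTop_iff_nat N).2 ha.1)
  obtain ⟨i, hi⟩ := (hb.eventually hK0).exists
  exact hk i (b i) hi (hab i)

theorem IsProP.exists_pow_smul_eq_zero [DiscreteTopology G] (hp : p.Prime) (hG : IsProP G p)
    (x : G) : ∃ k : ℕ, p ^ k • x = 0 :=
  ((hG.isTopologicalPGroupLC hp x).eventually ((isOpen_discrete {0}).mem_nhds rfl)).exists

end LocallyCompact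

/-! ### Injectivity in the categories of pro-`p` groups -/

section Category

variable {P : ObjectProperty (TopModuleCat.{u} ℤ)} {p : ℕ}

theorem exists_comp_eq_of_divisible {K A I : TopModuleCat.{u} ℤ} [NonarchimedeanAddGroup A]
    [DiscreteTopology I] (hdiv : ∀ n : ℕ, n ≠ 0 → ∀ x : I, ∃ y : I, n • y = x) (i : K ⟶ A)
    (hi : IsInducing i.hom) (φ : K ⟶ I) : ∃ ψ : A ⟶ I, i ≫ ψ = φ := by
  obtain ⟨ψ, hψ⟩ := exists_extension_of_divisible hdiv i.hom hi φ.hom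
  exact ⟨TopModuleCat.ofHom ψ, ConcreteCategory.ext (ContinuousLinearMap.ext hψ)⟩

/-- A discrete divisible group is injective in any category of pro-`p` Polish groups that is closed
under kernels. -/
theorem isInjective_of_divisible (hp : p.Prime) (hP : P ≤ proP p)
    (hker : ∀ {A B : TopModuleCat.{u} ℤ} (g : A ⟶ B), P A → P B →
      P (TopModuleCat.ker g))
    (I : P.FullSubcategory) [DiscreteTopology I.obj]
    (hdiv : ∀ n : ℕ, n ≠ 0 → ∀ x : I.obj, ∃ y : I.obj, n • y = x) : IsInjective I := by
  rintro S ⟨⟨hf⟩, ⟨hg⟩⟩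
  refine ⟨fun h h' hh => Cofork.IsColimit.hom_ext hg hh, fun h => ⟨fun hh => ?_, ?_⟩, fun φ => ?_⟩
  · exact ⟨_, (CokernelCofork.IsColimit.desc' hg h hh).2⟩
  · rintro ⟨k, rfl⟩
    simp only
    rw [← Category.assoc, S.zero, zero_comp]
  -- `S.f` is a kernel only in the categorical sense. Comparing it with the topological kernel `K`
  -- replaces it by a map known to be inducing.
  · let K : P.FullSubcategory := ⟨_, hker S.g.hom S.X₂.property S.X₃.property⟩
    let i : K ⟶ S.X₂ := P.homMk (TopModuleCat.kerι S.g.hom)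
    obtain ⟨l, hl⟩ := KernelFork.IsLimit.lift' hf i (P.hom_ext (TopModuleCat.kerι_comp _))
    obtain ⟨r', hr'⟩ := KernelFork.IsLimit.lift' (TopModuleCat.isLimitKer S.g.hom) S.f.hom
      congr(($(S.zero)).hom)
    let r : S.X₁ ⟶ K := P.homMk r'
    have hr : r ≫ i = S.f := P.hom_ext hr'
    have hrl : r ≫ l = 𝟙 _ := Fork.IsLimit.hom_ext hf (by
      change (r ≫ l) ≫ S.f = 𝟙 _ ≫ S.f
      rw [Category.assoc, Category.id_comp]
      exact (congrArg (r ≫ ·) hl).trans hr)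
    have : NonarchimedeanAddGroup S.X₂.obj := (hP _ S.X₂.property).nonarchimedeanAddGroup hp
    obtain ⟨ψ, hψ⟩ := exists_comp_eq_of_divisible hdiv i.hom ⟨rfl⟩ (l ≫ φ).hom
    have hiψ : i ≫ P.homMk ψ = l ≫ φ := P.hom_ext hψ
    refine ⟨P.homMk ψ, ?_⟩
    change S.f ≫ _ = φ
    rw [← hr, Category.assoc, hiψ, ← Category.assoc, hrl, Category.id_comp]

/-- A continuous homomorphism whose values lie in the range of a linear embedding factors through
that embedding. -/
theorem exists_comp_eq_of_isEmbedding {R X Y T : Type*} [Ring R] [AddCommGroup X]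
    [TopologicalSpace X] [Module R X] [AddCommGroup Y] [TopologicalSpace Y] [Module R Y]
    [AddCommGroup T] [TopologicalSpace T] [Module R T] (f : X →L[R] Y) (hf : IsEmbedding f)
    (t : T →L[R] Y) (ht : ∀ x, t x ∈ f.range) : ∃ s : T →L[R] X, f.comp s = t := by
  let e := LinearEquiv.ofInjective (f : X →ₗ[R] Y) hf.injective
  let s : T →ₗ[R] X := (e.symm : _ →ₗ[R] X) ∘ₗ (t : T →ₗ[R] Y).codRestrict _ ht
  have hs : ∀ x, f (s x) = t x := fun x =>
    congrArg Subtype.val (e.apply_symm_apply ⟨t x, ht x⟩)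
  refine ⟨⟨s, hf.isInducing.continuous_iff.2 ?_⟩, ContinuousLinearMap.ext hs⟩
  exact t.continuous.congr fun x => (hs x).symm

/-- Coordinatewise multiplication by natural numbers on a power of the `p`-adic integers, as a
morphism of topological modules. -/
noncomputable abbrev padicIntPiMulHom (p : ℕ) [Fact p.Prime] {ι : Type u} (k : ι → ℕ) :
    TopModuleCat.of ℤ (ι → ℤ_[p]) ⟶ TopModuleCat.of ℤ (ι → ℤ_[p]) :=
  TopModuleCat.ofHom (padicIntPiMul p k)

theorem lcProP_padicInt_pi [Fact p.Prime] {ι : Type u} [Countable ι] :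
    lcProP p (TopModuleCat.of ℤ (ι → ℤ_[p])) :=
  ⟨inferInstanceAs (LocallyCompactSpace (ι → ℤ_[p])), isProP_padicInt_pi⟩

theorem lcProP_coker_padicIntPiMulHom [Fact p.Prime] {ι : Type u} [Countable ι] {k : ι → ℕ}
    (hk : ∀ i, k i ≠ 0) : lcProP p (TopModuleCat.coker (padicIntPiMulHom p k)) := by
  have h := isProP_padicInt_pi_quotient (padicIntPiMul p k).range
    (isClosedEmbedding_padicIntPiMul hk).isClosed_range
  have := h.polish
  have : CompactSpace ((ι → ℤ_[p]) ⧸ (padicIntPiMul p k).range) := Quotient.compactSpace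
  exact ⟨inferInstanceAs (LocallyCompactSpace ((ι → ℤ_[p]) ⧸ (padicIntPiMul p k).range)), h⟩

/-- Coordinatewise multiplication by nonzero natural numbers on a countable power of the `p`-adic
integers, followed by the projection to its cokernel. -/
noncomputable abbrev padicIntPiMulComplex [Fact p.Prime] {ι : Type u} [Countable ι]
    (hP : lcProP p ≤ P) {k : ι → ℕ} (hk : ∀ i, k i ≠ 0) : ShortComplex P.FullSubcategory where
  X₁ := ⟨TopModuleCat.of ℤ (ι → ℤ_[p]), hP _ lcProP_padicInt_pi⟩
  X₂ := ⟨TopModuleCat.of ℤ (ι → ℤ_[p]), hP _ lcProP_padicInt_pi⟩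
  X₃ := ⟨TopModuleCat.coker (padicIntPiMulHom p k), hP _ (lcProP_coker_padicIntPiMulHom hk)⟩
  f := P.homMk (padicIntPiMulHom p k)
  g := P.homMk (TopModuleCat.cokerπ _)
  zero := P.hom_ext (TopModuleCat.comp_cokerπ _)

theorem isKernelCokernelPair_padicIntPiMulComplex [Fact p.Prime] {ι : Type u} [Countable ι]
    (hP : lcProP p ≤ P) {k : ι → ℕ} (hk : ∀ i, k i ≠ 0) :
    IsKernelCokernelPair (padicIntPiMulComplex hP hk) := by
  have he := isClosedEmbedding_padicIntPiMul (p := p) hk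
  have hmono : Mono (padicIntPiMulComplex hP hk).f := ⟨fun s t h => by
    ext x : 3
    exact he.injective congr(($h).hom.hom x)⟩
  have hepi : Epi (padicIntPiMulComplex hP hk).g := ⟨fun s t h =>
    P.hom_ext ((cancel_epi (TopModuleCat.cokerπ _)).1 congr(($h).hom))⟩
  refine ⟨⟨KernelFork.IsLimit.ofι' _ _ fun {T} t ht => ?_⟩,
    ⟨CokernelCofork.IsColimit.ofπ' _ _ fun {T} t ht => ?_⟩⟩
  · have h := exists_comp_eq_of_isEmbedding _ he.isEmbedding t.hom.hom fun x =>
      (Submodule.Quotient.mk_eq_zero _).1 congr(($ht).hom.hom x)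
    refine ⟨P.homMk (TopModuleCat.ofHom h.choose), ?_⟩
    ext x : 3
    exact congr($(h.choose_spec) x)
  · have h := CokernelCofork.IsColimit.desc' (TopModuleCat.isColimitCoker (padicIntPiMulHom p k))
      t.hom congr(($ht).hom)
    exact ⟨P.homMk h.1, P.hom_ext h.2⟩

/-- The test sequences consist of compact groups, so they lie in every `P` between `lcProP p` and
`proP p`; this treats both categories at once. -/
theorem IsInjective.countable_divisible_pGroup (hp : p.Prime) (h₁ : lcProP p ≤ P)
    (h₂ : P ≤ proP p) {I : P.FullSubcategory} [LocallyCompactSpace I.obj] (hI : IsInjective I) :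
    Countable I.obj ∧ (∀ n : ℕ, n ≠ 0 → ∀ x : I.obj, ∃ y : I.obj, n • y = x) ∧
      ∀ x : I.obj, ∃ k : ℕ, p ^ k • x = 0 := by
  have : Fact p.Prime := ⟨hp⟩
  have hG : IsProP I.obj p := h₂ _ I.property
  have := hG.polish
  have hdiv : ∀ (k : ℕ → ℕ) (a : ℕ → I.obj), (∀ i, k i ≠ 0) → Tendsto a atTop (𝓝 0) →
      ∃ b : ℕ → I.obj, Tendsto b atTop (𝓝 0) ∧ ∀ i, k i • b i = a i := by
    intro k a hk ha
    rw [← Nat.cofinite_eq_atTop] at ha ⊢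
    have hext (φ : (ULift.{u} ℕ → ℤ_[p]) →L[ℤ] I.obj) :
        ∃ ψ : (ULift.{u} ℕ → ℤ_[p]) →L[ℤ] I.obj,
          ψ.comp (padicIntPiMul p fun i => k i.down) = φ := by
      have hS := isKernelCokernelPair_padicIntPiMulComplex h₁ fun i : ULift.{u} ℕ => hk i.down
      obtain ⟨ψ, hψ⟩ := (hI _ hS).2.2 (P.homMk (TopModuleCat.ofHom φ))
      exact ⟨ψ.hom.hom, congr(($hψ).hom.hom)⟩
    obtain ⟨b, hb, hba⟩ := exists_null_family_of_extension hG hext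
      (ha.comp ULift.down_injective.tendsto_cofinite)
    exact ⟨b ∘ ULift.up, hb.comp ULift.up_injective.tendsto_cofinite, fun i => hba ⟨i⟩⟩
  have : DiscreteTopology I.obj := hG.discreteTopology_of_null_division hp fun k a ha =>
    hdiv (fun i => p ^ k i) a (fun i => pow_ne_zero _ hp.ne_zero) ha
  refine ⟨TopologicalSpace.separableSpace_iff_countable.1 inferInstance, fun n hn x => ?_,
    hG.exists_pow_smul_eq_zero hp⟩
  -- Divide the null sequence `x, 0, 0, …` by the constant `n`.
  obtain ⟨b, -, hb⟩ := hdiv (fun _ => n) (fun i => if i = 0 then x else 0) (fun _ => hn)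
    (tendsto_const_nhds.congr' <| by
      filter_upwards [eventually_ne_atTop 0] with i hi
      rw [if_neg hi])
  exact ⟨b 0, by simpa using hb 0⟩

theorem proP_ker (hp : p.Prime) {A B : TopModuleCat.{u} ℤ} (g : A ⟶ B) (hA : proP p A)
    (hB : proP p B) : proP p (TopModuleCat.ker g) := by
  have : PolishSpace B := hB.polish
  have hc : IsClosed (g.hom.ker : Set A) := g.hom.isClosed_ker
  exact IsProP.of_isClosedEmbedding hp hA (Submodule.subtype _).toAddMonoidHom
    hc.isClosedEmbedding_subtypeVal

theorem lcProP_ker (hp : p.Prime) {A B : TopModuleCat.{u} ℤ} (g : A ⟶ B) (hA : lcProP p A)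
    (hB : lcProP p B) : lcProP p (TopModuleCat.ker g) := by
  have : PolishSpace B := hB.2.polish
  have : LocallyCompactSpace A := hA.1
  have hc : IsClosed (g.hom.ker : Set A) := g.hom.isClosed_ker
  exact ⟨hc.isClosedEmbedding_subtypeVal.locallyCompactSpace, proP_ker hp g hA.2 hB.2⟩

end Category

end PolishAb

theorem mainTheorem7 (p : ℕ) (hp : p.Prime) (G : Type u) [AddCommGroup G] [TopologicalSpace G]
    [IsTopologicalAddGroup G] [LocallyCompactSpace G] (hG : PolishAb.IsProP G p) :
    List.TFAE [
      PolishAb.IsInjective (⟨TopModuleCat.of ℤ G, ‹LocallyCompactSpace G›, hG⟩ :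
        PolishAb.LCPAb.{u} p),
      PolishAb.IsInjective (⟨TopModuleCat.of ℤ G, hG⟩ : PolishAb.PAb.{u} p),
      Countable G ∧ (∀ n : ℕ, n ≠ 0 → ∀ x : G, ∃ y : G, n • y = x) ∧
        ∀ x : G, ∃ k : ℕ, (p ^ k) • x = 0] := by
  have h₁₂ : PolishAb.lcProP.{u} p ≤ PolishAb.proP p := fun _ h => h.2
  tfae_have 1 → 3 := fun h => h.countable_divisible_pGroup hp le_rfl h₁₂
  tfae_have 2 → 3 := fun h =>
    have : LocallyCompactSpace (TopModuleCat.of ℤ G) := ‹LocallyCompactSpace G›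
    h.countable_divisible_pGroup hp h₁₂ le_rfl
  tfae_have 3 → 1 := fun ⟨_, hdiv, _⟩ =>
    have := hG.polish
    have : DiscreteTopology (TopModuleCat.of ℤ G) :=
      PolishAb.discreteTopology_of_countable (A := G)
    PolishAb.isInjective_of_divisible hp h₁₂ (PolishAb.lcProP_ker hp) _ hdiv
  tfae_have 3 → 2 := fun ⟨_, hdiv, _⟩ =>
    have := hG.polish
    have : DiscreteTopology (TopModuleCat.of ℤ G) :=
      PolishAb.discreteTopology_of_countable (A := G)
    PolishAb.isInjective_of_divisible hp le_rfl (PolishAb.proP_ker hp) _ hdiv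
  tfae_finish
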